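/- Let $k$ be an algebraically closed field of characteristic $0$. For a Hopf algebra $(A,m,1,\Delta,\varepsilon,S)$ over $k$, a *twist* for $A$ is an invertible element $J\in A\otimes A$ with $$(\Delta\otimes \mathrm{id})(J)\,(J\otimes 1)=(\mathrm{id}\otimes\Delta)(J)\,(1\otimes J),\qquad (\varepsilon\otimes \mathrm{id})(J)=(\mathrm{id}\otimes\varepsilon)(J)=1 .$$ Write $J_{21}$ for the image of $J$ under $a\otimes b\mapsto b\otimes a$. For a twist $J$, $A^J$ denotes the Hopf algebra with the same algebra structure and counit as $A$, with comultiplication $\Delta^J(a)=J^{-1}\Delta(a)J$ and antipode $S^J(a)=Q^{-1}S(a)Q$, where $Q=m\big((S\otimes \mathrm{id})(J)\big)$. If $A=k[G]$ is the group algebra of a finite group $G$ (with its usual Hopf algebra structure and $R$-matrix $1\otimes 1$), then $(k[G]^J,\,J_{21}^{-1}J)$ is a triangular Hopf algebra. An isomorphism of triangular Hopf algebras $(A,R)\to(B,R')$ is an isomorphism $f:A\to B$ of Hopf algebras with $(f\otimes f)(R)=R'$. Two twists $J_1,J_2$ for $A$ are *gauge equivalent* if there is an invertible $x\in A$ with $\varepsilon(x)=1$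 and $J_2=\Delta(x)\,J_1\,(x^{-1}\otimes x^{-1})$. **Lemma (uniqueness).** Let $G,G'$ be finite groups and let $J,J'$ be twists for $k[G],k[G']$ respectively. Suppose that the triangular Hopf algebras $(k[G]^J,\,J_{21}^{-1}J)$ and $(k[G']^{J'},\,(J'_{21})^{-1}J')$ are isomorphic. Then there exists a group isomorphism $\phi:G\to G'$ such that $(\phi\otimes\phi)(J)$ is gauge equivalent to $J'$ as twists for $k[G']$, where $\phi$ also denotes its linear extension $k[G]\to k[G']$. -/

import Mathlib

open scoped TensorProduct

noncomputable section

namespace TwistedHopf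

/-! ### Tensor legs -/

section Legs

variable (k A : Type*) [CommRing k] [Ring A]

section Alg
variable [Algebra k A]

/-- The permutation `τ (a ⊗ b) = b ⊗ a`, as an algebra automorphism of `A ⊗ A`. -/
abbrev flip : A ⊗[k] A ≃ₐ[k] A ⊗[k] A := Algebra.TensorProduct.comm k A A

/-- `X₁₂`: the map `a ⊗ b ↦ a ⊗ b ⊗ 1`. -/
def leg12 : A ⊗[k] A →ₐ[k] A ⊗[k] (A ⊗[k] A) :=
  Algebra.TensorProduct.map (AlgHom.id k A) Algebra.TensorProduct.includeLeft

/-- `X₁₃`: the map `a ⊗ b ↦ a ⊗ 1 ⊗ b`. -/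
def leg13 : A ⊗[k] A →ₐ[k] A ⊗[k] (A ⊗[k] A) :=
  Algebra.TensorProduct.map (AlgHom.id k A) Algebra.TensorProduct.includeRight

/-- `X₂₃`: the map `a ⊗ b ↦ 1 ⊗ a ⊗ b`. -/
def leg23 : A ⊗[k] A →ₐ[k] A ⊗[k] (A ⊗[k] A) :=
  Algebra.TensorProduct.includeRight

end Alg

variable [Bialgebra k A]

/-- `Δ ⊗ id`, with values in `A ⊗ (A ⊗ A)`. -/
def comulLeft : A ⊗[k] A →ₐ[k] A ⊗[k] (A ⊗[k] A) :=
  (Algebra.TensorProduct.assoc k k k A A A).toAlgHom.comp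
    (Algebra.TensorProduct.map (Bialgebra.comulAlgHom k A) (AlgHom.id k A))

/-- `id ⊗ Δ`. -/
def comulRight : A ⊗[k] A →ₐ[k] A ⊗[k] (A ⊗[k] A) :=
  Algebra.TensorProduct.map (AlgHom.id k A) (Bialgebra.comulAlgHom k A)

/-- `ε ⊗ id`, with values in `k ⊗ A = A`. -/
def counitLeft : A ⊗[k] A →ₐ[k] A :=
  (Algebra.TensorProduct.lid k A).toAlgHom.comp
    (Algebra.TensorProduct.map (Bialgebra.counitAlgHom k A) (AlgHom.id k A))

/-- `id ⊗ ε`, with values in `A ⊗ k = A`. -/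
def counitRight : A ⊗[k] A →ₐ[k] A :=
  (Algebra.TensorProduct.rid k k A).toAlgHom.comp
    (Algebra.TensorProduct.map (AlgHom.id k A) (Bialgebra.counitAlgHom k A))

end Legs

section LegLemmas

variable {k A : Type*} [CommRing k] [Ring A]

section Alg
variable [Algebra k A]

@[simp] lemma leg12_tmul (a b : A) : leg12 k A (a ⊗ₜ b) = a ⊗ₜ (b ⊗ₜ 1) := rfl
@[simp] lemma leg13_tmul (a b : A) : leg13 k A (a ⊗ₜ b) = a ⊗ₜ (1 ⊗ₜ b) := rfl
@[simp] lemma leg23_tmul (a b : A) : leg23 k A (a ⊗ₜ b) = 1 ⊗ₜ (a ⊗ₜ b) := rfl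

/-- The cyclic permutation `x ⊗ y ⊗ z ↦ y ⊗ z ⊗ x`. -/
def cyc (k A : Type*) [CommRing k] [Ring A] [Algebra k A] :
    A ⊗[k] (A ⊗[k] A) ≃ₐ[k] A ⊗[k] (A ⊗[k] A) :=
  (Algebra.TensorProduct.comm k A (A ⊗[k] A)).trans (Algebra.TensorProduct.assoc k k k A A A)

@[simp] lemma cyc_tmul (a b c : A) :
    cyc k A (a ⊗ₜ (b ⊗ₜ c)) = b ⊗ₜ (c ⊗ₜ a) := rfl

/-- The permutation `x ⊗ y ⊗ z ↦ x ⊗ z ⊗ y`. -/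
def swap23 (k A : Type*) [CommRing k] [Ring A] [Algebra k A] :
    A ⊗[k] (A ⊗[k] A) →ₐ[k] A ⊗[k] (A ⊗[k] A) :=
  Algebra.TensorProduct.map (AlgHom.id k A) (flip k A).toAlgHom

@[simp] lemma swap23_tmul (a b c : A) :
    swap23 k A (a ⊗ₜ (b ⊗ₜ c)) = a ⊗ₜ (c ⊗ₜ b) := rfl

/-- Conjugation `b ↦ u⁻¹ b u` by an invertible element, as an algebra endomorphism. -/
def conjHom (u : Aˣ) : A →ₐ[k] A where
  toFun b := ↑u⁻¹ * b * u
  map_one' := by simp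
  map_mul' x y := by
    calc (↑u⁻¹ * (x * y) * u : A) = ↑u⁻¹ * x * (u * ↑u⁻¹) * y * u := by
          simp [mul_assoc]
      _ = _ := by simp only [mul_assoc]
  map_zero' := by simp
  map_add' x y := by simp [mul_add, add_mul]
  commutes' r := by
    rw [mul_assoc, Algebra.commutes r (u : A), ← mul_assoc]; simp

/-- The map induced by an algebra homomorphism on invertible elements. -/
def mapUnit {B : Type*} [Ring B] [Algebra k B] (f : A →ₐ[k] B) : Aˣ →* Bˣ :=
  Units.map (f : A →* B)

@[simp] lemma coe_mapUnit {B : Type*} [Ring B] [Algebra k B] (f : A →ₐ[k] B) (u : Aˣ) :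
    (mapUnit f u : B) = f u := rfl

@[simp] lemma coe_mapUnit_inv {B : Type*} [Ring B] [Algebra k B] (f : A →ₐ[k] B) (u : Aˣ) :
    (↑(mapUnit f u)⁻¹ : B) = f ↑u⁻¹ := rfl

lemma conjHom_apply (u : Aˣ) (b : A) : conjHom (k := k) u b = ↑u⁻¹ * b * u := rfl

end Alg

variable [Bialgebra k A]

lemma comulLeft_tmul (a b : A) : comulLeft k A (a ⊗ₜ b) =
    Algebra.TensorProduct.assoc k k k A A A (Coalgebra.comul a ⊗ₜ[k] b) := rfl
lemma comulRight_tmul (a b : A) : comulRight k A (a ⊗ₜ b) = a ⊗ₜ[k] Coalgebra.comul b := rfl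
@[simp] lemma counitLeft_tmul (a b : A) :
    counitLeft k A (a ⊗ₜ b) = Coalgebra.counit (R := k) a • b := rfl
@[simp] lemma counitRight_tmul (a b : A) :
    counitRight k A (a ⊗ₜ b) = Coalgebra.counit (R := k) b • a := rfl

lemma comulLeft_comul (a : A) :
    comulLeft k A (Coalgebra.comul a) = comulRight k A (Coalgebra.comul a) :=
  Coalgebra.coassoc_apply a

lemma counitLeft_comul (a : A) : counitLeft k A (Coalgebra.comul a) = a := by
  have h : counitLeft k A (Coalgebra.comul a) =
      Algebra.TensorProduct.lid k A (LinearMap.rTensor A Coalgebra.counit (Coalgebra.comul a)) := rfl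
  rw [h, Coalgebra.rTensor_counit_comul]; simp

lemma counitRight_comul (a : A) : counitRight k A (Coalgebra.comul a) = a := by
  have h : counitRight k A (Coalgebra.comul a) =
      Algebra.TensorProduct.rid k k A
        (LinearMap.lTensor A Coalgebra.counit (Coalgebra.comul a)) := rfl
  rw [h, Coalgebra.lTensor_counit_comul]; simp

lemma cyc_leg12 (x : A ⊗[k] A) : cyc k A (leg12 k A x) = leg13 k A (flip k A x) := by
  induction x with
  | zero => simp
  | tmul a b => rfl
  | add x y hx hy => simp only [map_add, hx, hy]

lemma cyc_leg13 (x : A ⊗[k] A) : cyc k A (leg13 k A x) = leg23 k A (flip k A x) := by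
  induction x with
  | zero => simp
  | tmul a b => rfl
  | add x y hx hy => simp only [map_add, hx, hy]

lemma cyc_leg23 (x : A ⊗[k] A) : cyc k A (leg23 k A x) = leg12 k A x := by
  induction x with
  | zero => simp
  | tmul a b => rfl
  | add x y hx hy => simp only [map_add, hx, hy]

lemma cyc_comulRight (x : A ⊗[k] A) :
    cyc k A (comulRight k A x) = comulLeft k A (flip k A x) := by
  induction x with
  | zero => simp
  | tmul a b => rfl
  | add x y hx hy => simp only [map_add, hx, hy]

lemma swap23_leg12 (x : A ⊗[k] A) : swap23 k A (leg12 k A x) = leg13 k A x := by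
  induction x with
  | zero => simp
  | tmul a b => rfl
  | add x y hx hy => simp only [map_add, hx, hy]

lemma swap23_leg23 (x : A ⊗[k] A) : swap23 k A (leg23 k A x) = leg23 k A (flip k A x) := by
  induction x with
  | zero => simp
  | tmul a b => rfl
  | add x y hx hy => simp only [map_add, hx, hy]

lemma leg23_mul_comulRight {R : A ⊗[k] A}
    (hR : ∀ a : A, flip k A (Coalgebra.comul a) * R = R * Coalgebra.comul a) (x : A ⊗[k] A) :
    leg23 k A R * comulRight k A x = swap23 k A (comulRight k A x) * leg23 k A R := by
  induction x with
  | zero => simp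
  | tmul a b =>
    have h : ∀ y : A ⊗[k] A, leg23 k A y = (1 : A) ⊗ₜ[k] y := fun _ => rfl
    have h2 : ∀ y : A ⊗[k] A, swap23 k A (a ⊗ₜ[k] y) = a ⊗ₜ[k] flip k A y := fun _ => rfl
    rw [comulRight_tmul, h, h2, Algebra.TensorProduct.tmul_mul_tmul,
      Algebra.TensorProduct.tmul_mul_tmul, hR]
    simp
  | add x y hx hy => simp only [map_add, mul_add, add_mul, hx, hy]

lemma leg13_mul_swap23 {R : A ⊗[k] A}
    (hR : ∀ a : A, flip k A (Coalgebra.comul a) * R = R * Coalgebra.comul a) (x : A ⊗[k] A) :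
    leg13 k A R * swap23 k A (comulLeft k A x) = cyc k A (comulLeft k A x) * leg13 k A R := by
  induction x with
  | zero => simp
  | tmul a b =>
    have h1 : ∀ y : A ⊗[k] A, swap23 k A (Algebra.TensorProduct.assoc k k k A A A (y ⊗ₜ b)) =
        leg13 k A y * ((1 : A) ⊗ₜ[k] (b ⊗ₜ[k] (1 : A))) := by
      intro y
      induction y with
      | zero => simp
      | tmul c d => simp
      | add x y hx hy => simp only [map_add, TensorProduct.add_tmul, add_mul, hx, hy]
    have h2 : ∀ y : A ⊗[k] A, cyc k A (Algebra.TensorProduct.assoc k k k A A A (y ⊗ₜ b)) =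
        ((1 : A) ⊗ₜ[k] (b ⊗ₜ[k] (1 : A))) * leg13 k A (flip k A y) := by
      intro y
      induction y with
      | zero => simp
      | tmul c d => simp
      | add x y hx hy => simp only [map_add, TensorProduct.add_tmul, mul_add, hx, hy]
    have h3 : ∀ y : A ⊗[k] A, leg13 k A y * ((1 : A) ⊗ₜ[k] (b ⊗ₜ[k] (1 : A))) =
        ((1 : A) ⊗ₜ[k] (b ⊗ₜ[k] (1 : A))) * leg13 k A y := by
      intro y
      induction y with
      | zero => simp
      | tmul c d => simp
      | add x y hx hy => simp only [map_add, add_mul, mul_add, hx, hy]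
    rw [comulLeft_tmul, h1, h2, ← mul_assoc, ← map_mul, ← hR, h3, map_mul, mul_assoc]
  | add x y hx hy => simp only [map_add, mul_add, add_mul, hx, hy]

end LegLemmas

/-! ### Maps built from the antipode -/

section Antipode

variable {k A : Type*} [CommRing k] [Ring A] [HopfAlgebra k A]

/-- `a ⊗ b ↦ S(a) p b`. -/
def antL (k : Type*) {A : Type*} [CommRing k] [Ring A] [HopfAlgebra k A] (p : A) :
    A ⊗[k] A →ₗ[k] A :=
  LinearMap.mul' k A ∘ₗ
    TensorProduct.map (LinearMap.mulRight k p ∘ₗ HopfAlgebra.antipode k) LinearMap.id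

/-- `a ⊗ b ↦ a p S(b)`. -/
def antR (k : Type*) {A : Type*} [CommRing k] [Ring A] [HopfAlgebra k A] (p : A) :
    A ⊗[k] A →ₗ[k] A :=
  LinearMap.mul' k A ∘ₗ
    TensorProduct.map LinearMap.id (LinearMap.mulLeft k p ∘ₗ HopfAlgebra.antipode k)

@[simp] lemma antL_tmul (p a b : A) :
    antL k p (a ⊗ₜ b) = HopfAlgebra.antipode k a * p * b := rfl
@[simp] lemma antR_tmul (p a b : A) :
    antR k p (a ⊗ₜ b) = a * (p * HopfAlgebra.antipode k b) := rfl

lemma antL_add (p q : A) (x : A ⊗[k] A) : antL k (p + q) x = antL k p x + antL k q x := by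
  induction x with
  | zero => simp
  | tmul a b => simp [mul_add, add_mul]
  | add x y hx hy => simp only [map_add, hx, hy]; abel

lemma antR_add (p q : A) (x : A ⊗[k] A) : antR k (p + q) x = antR k p x + antR k q x := by
  induction x with
  | zero => simp
  | tmul a b => simp [mul_add, add_mul]
  | add x y hx hy => simp only [map_add, hx, hy]; abel

lemma antL_smul (r : k) (p : A) (x : A ⊗[k] A) : antL k (r • p) x = r • antL k p x := by
  induction x with
  | zero => simp
  | tmul a b => simp
  | add x y hx hy => simp only [map_add, smul_add, hx, hy]

lemma antR_smul (r : k) (p : A) (x : A ⊗[k] A) : antR k (r • p) x = r • antR k p x := by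
  induction x with
  | zero => simp
  | tmul a b => simp
  | add x y hx hy => simp only [map_add, smul_add, hx, hy]

lemma antL_mul (p : A) (x y : A ⊗[k] A) : antL k p (x * y) = antL k (antL k p x) y := by
  induction x with
  | zero => simpa using (antL_smul (0 : k) (0 : A) y).symm
  | tmul a b =>
    induction y with
    | zero => simp
    | tmul c d => simp [HopfAlgebra.antipode_mul_antidistrib, mul_assoc]
    | add x y hx hy => simp only [map_add, mul_add, hx, hy]
  | add x z hx hz => simp only [map_add, add_mul, antL_add, hx, hz]

lemma antR_mul (p : A) (x y : A ⊗[k] A) : antR k p (x * y) = antR k (antR k p y) x := by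
  induction y with
  | zero => simpa using (antR_smul (0 : k) (0 : A) x).symm
  | tmul a b =>
    induction x with
    | zero => simp
    | tmul c d => simp [HopfAlgebra.antipode_mul_antidistrib, mul_assoc]
    | add x y hx hy => simp only [map_add, add_mul, hx, hy]
  | add x z hx hz => simp only [map_add, mul_add, antR_add, hx, hz]

lemma antL_comul (a : A) :
    antL k 1 (Coalgebra.comul a) = Coalgebra.counit (R := k) a • (1 : A) := by
  have h : antL k (1 : A) = LinearMap.mul' k A ∘ₗ (HopfAlgebra.antipode k).rTensor A := by
    ext; simp
  rw [h]
  have := LinearMap.congr_fun (HopfAlgebra.mul_antipode_rTensor_comul (R := k) (A := A)) a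
  simpa [Algebra.algebraMap_eq_smul_one] using this

lemma antR_comul (a : A) :
    antR k 1 (Coalgebra.comul a) = Coalgebra.counit (R := k) a • (1 : A) := by
  have h : antR k (1 : A) = LinearMap.mul' k A ∘ₗ (HopfAlgebra.antipode k).lTensor A := by
    ext; simp
  rw [h]
  have := LinearMap.congr_fun (HopfAlgebra.mul_antipode_lTensor_comul (R := k) (A := A)) a
  simpa [Algebra.algebraMap_eq_smul_one] using this

/-- `a ⊗ b ⊗ c ↦ S(a) b S(c)`. -/
def antL3 (k A : Type*) [CommRing k] [Ring A] [HopfAlgebra k A] : A ⊗[k] (A ⊗[k] A) →ₗ[k] A :=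
  LinearMap.mul' k A ∘ₗ TensorProduct.map (HopfAlgebra.antipode k) (antR k 1)

/-- `a ⊗ b ⊗ c ↦ a S(b) c`. -/
def antR3 (k A : Type*) [CommRing k] [Ring A] [HopfAlgebra k A] : A ⊗[k] (A ⊗[k] A) →ₗ[k] A :=
  LinearMap.mul' k A ∘ₗ TensorProduct.map LinearMap.id (antL k 1)

lemma antL3_tmul (a : A) (x : A ⊗[k] A) :
    antL3 k A (a ⊗ₜ x) = HopfAlgebra.antipode k a * antR k 1 x := rfl
lemma antR3_tmul (a : A) (x : A ⊗[k] A) :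
    antR3 k A (a ⊗ₜ x) = a * antL k 1 x := rfl

lemma antL3_legs (x y : A ⊗[k] A) :
    antL3 k A (leg12 k A x * leg23 k A y) = antL k 1 x * antR k 1 y := by
  induction x with
  | zero => simp
  | tmul a b =>
    induction y with
    | zero => simp
    | tmul c d => simp [antL3_tmul, mul_assoc]
    | add x y hx hy => simp only [map_add, mul_add, hx, hy]
  | add x z hx hz => simp only [map_add, add_mul, hx, hz]

lemma antR3_legs (x y : A ⊗[k] A) :
    antR3 k A (leg23 k A x * leg12 k A y) = antR k 1 y * antL k 1 x := by
  induction x with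
  | zero => simp
  | tmul a b =>
    induction y with
    | zero => simp
    | tmul c d => simp [antR3_tmul, mul_assoc, HopfAlgebra.antipode_mul_antidistrib]
    | add x y hx hy => simp only [map_add, mul_add, add_mul, hx, hy]
  | add x z hx hz => simp only [map_add, add_mul, mul_add, hx, hz]

lemma antL3_comul (x y : A ⊗[k] A) :
    antL3 k A (comulLeft k A x * comulRight k A y) =
      HopfAlgebra.antipode k (counitRight k A y) * HopfAlgebra.antipode k (counitLeft k A x) := by
  induction x with
  | zero => simp
  | tmul c d =>
    induction y with
    | zero => simp
    | tmul a b =>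
      have h : ∀ w v : A ⊗[k] A, antL3 k A
          (Algebra.TensorProduct.assoc k k k A A A (w ⊗ₜ[k] d) * (a ⊗ₜ[k] v)) =
          HopfAlgebra.antipode k a * antL k 1 w * antR k 1 v * HopfAlgebra.antipode k d := by
        intro w v
        induction w with
        | zero => simp
        | tmul p q =>
          induction v with
          | zero => simp
          | tmul r s => simp [antL3_tmul, mul_assoc, HopfAlgebra.antipode_mul_antidistrib]
          | add x y hx hy =>
            simp only [map_add, mul_add, add_mul, TensorProduct.tmul_add, hx, hy]
        | add x y hx hy =>
          simp only [map_add, mul_add, add_mul, TensorProduct.add_tmul, hx, hy]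
      rw [comulLeft_tmul, comulRight_tmul, h, antL_comul, antR_comul]
      simp [smul_smul, mul_comm]
    | add x y hx hy => simp only [map_add, mul_add, add_mul, hx, hy]
  | add x z hx hz => simp only [map_add, add_mul, mul_add, hx, hz]

lemma antR3_comul (x y : A ⊗[k] A) :
    antR3 k A (comulRight k A x * comulLeft k A y) =
      counitRight k A x * counitLeft k A y := by
  induction x with
  | zero => simp
  | tmul c d =>
    induction y with
    | zero => simp
    | tmul a b =>
      have h : ∀ w v : A ⊗[k] A, antR3 k A
          ((c ⊗ₜ[k] v) * Algebra.TensorProduct.assoc k k k A A A (w ⊗ₜ[k] b)) =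
          c * antR k 1 w * antL k 1 v * b := by
        intro w v
        induction w with
        | zero => simp
        | tmul p q =>
          induction v with
          | zero => simp
          | tmul r s => simp [antR3_tmul, mul_assoc, HopfAlgebra.antipode_mul_antidistrib]
          | add x y hx hy =>
            simp only [map_add, mul_add, add_mul, TensorProduct.tmul_add, hx, hy]
        | add x y hx hy =>
          simp only [map_add, mul_add, add_mul, TensorProduct.add_tmul, hx, hy]
      rw [comulLeft_tmul, comulRight_tmul, h, antL_comul, antR_comul]
      simp [smul_smul, mul_comm]
    | add x y hx hy => simp only [map_add, mul_add, add_mul, hx, hy]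
  | add x z hx hz => simp only [map_add, add_mul, mul_add, hx, hz]

end Antipode

/-! ### Twists -/

/-- A twist for the Hopf algebra `A`: an invertible `J ∈ A ⊗ A` with
`(Δ ⊗ id)(J) (J ⊗ 1) = (id ⊗ Δ)(J) (1 ⊗ J)` and `(ε ⊗ id)(J) = (id ⊗ ε)(J) = 1`. -/
structure Twist (k A : Type*) [CommRing k] [Ring A] [HopfAlgebra k A] where
  /-- The underlying invertible element. -/
  elem : (A ⊗[k] A)ˣ
  cocycle : comulLeft k A elem * leg12 k A elem = comulRight k A elem * leg23 k A elem
  counit_left : counitLeft k A elem = 1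
  counit_right : counitRight k A elem = 1

namespace Twist

variable {k A B : Type*} [CommRing k] [Ring A] [HopfAlgebra k A] [Ring B] [HopfAlgebra k B]

/-- Two twists are gauge equivalent if `J' = Jˣ = Δ(x) J (x⁻¹ ⊗ x⁻¹)` for an invertible
`x ∈ A` with `ε(x) = 1`. -/
def GaugeEquivalent (J J' : Twist k A) : Prop :=
  ∃ x : Aˣ, Coalgebra.counit (R := k) (x : A) = 1 ∧
    (J'.elem : A ⊗[k] A) =
      Coalgebra.comul (x : A) * (J.elem : A ⊗[k] A) * ((↑x⁻¹ : A) ⊗ₜ[k] (↑x⁻¹ : A))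

section Map

variable (f : A ≃ₐc[k] B)

/-- `f ⊗ f`. -/
def tensorMap : A ⊗[k] A →ₐ[k] B ⊗[k] B :=
  Algebra.TensorProduct.map (f : A →ₐ[k] B) (f : A →ₐ[k] B)

/-- `f ⊗ f ⊗ f`. -/
def tensorMap3 : A ⊗[k] (A ⊗[k] A) →ₐ[k] B ⊗[k] (B ⊗[k] B) :=
  Algebra.TensorProduct.map (f : A →ₐ[k] B) (tensorMap f)

lemma tensorMap_comul (a : A) :
    tensorMap f (Coalgebra.comul a) = Coalgebra.comul (R := k) (f a) :=
  CoalgHomClass.map_comp_comul_apply f a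

lemma leg12_map (x : A ⊗[k] A) : leg12 k B (tensorMap f x) = tensorMap3 f (leg12 k A x) := by
  induction x with
  | zero => simp
  | tmul a b => simp [tensorMap, tensorMap3]
  | add x y hx hy => simp only [map_add, hx, hy]

lemma leg23_map (x : A ⊗[k] A) : leg23 k B (tensorMap f x) = tensorMap3 f (leg23 k A x) := by
  induction x with
  | zero => simp
  | tmul a b => simp [tensorMap, tensorMap3]
  | add x y hx hy => simp only [map_add, hx, hy]

lemma comulRight_map (x : A ⊗[k] A) :
    comulRight k B (tensorMap f x) = tensorMap3 f (comulRight k A x) := by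
  induction x with
  | zero => simp
  | tmul a b =>
    have h : tensorMap f (a ⊗ₜ b) = f a ⊗ₜ[k] f b := rfl
    rw [h, comulRight_tmul, comulRight_tmul, ← tensorMap_comul]
    rfl
  | add x y hx hy => simp only [map_add, hx, hy]

lemma comulLeft_map (x : A ⊗[k] A) :
    comulLeft k B (tensorMap f x) = tensorMap3 f (comulLeft k A x) := by
  induction x with
  | zero => simp
  | tmul a b =>
    have h : tensorMap f (a ⊗ₜ b) = f a ⊗ₜ[k] f b := rfl
    rw [h, comulLeft_tmul, comulLeft_tmul, ← tensorMap_comul]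
    generalize (Coalgebra.comul a : A ⊗[k] A) = y
    induction y with
    | zero => simp
    | tmul c d => rfl
    | add x y hx hy => simp only [map_add, TensorProduct.add_tmul, hx, hy]
  | add x y hx hy => simp only [map_add, hx, hy]

lemma counitLeft_map (x : A ⊗[k] A) :
    counitLeft k B (tensorMap f x) = f (counitLeft k A x) := by
  induction x with
  | zero => simp
  | tmul a b => simp [tensorMap]
  | add x y hx hy => simp only [map_add, hx, hy]

lemma counitRight_map (x : A ⊗[k] A) :
    counitRight k B (tensorMap f x) = f (counitRight k A x) := by
  induction x with
  | zero => simp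
  | tmul a b => simp [tensorMap]
  | add x y hx hy => simp only [map_add, hx, hy]

/-- The image `(f ⊗ f)(J)` of a twist under an isomorphism of Hopf algebras. -/
def map (J : Twist k A) : Twist k B where
  elem := mapUnit (tensorMap f) J.elem
  cocycle := by
    have h : ((mapUnit (tensorMap f) J.elem : (B ⊗[k] B)ˣ) : B ⊗[k] B) =
      tensorMap f (J.elem : A ⊗[k] A) := rfl
    rw [h, leg12_map, leg23_map, comulLeft_map, comulRight_map, ← map_mul, ← map_mul, J.cocycle]
  counit_left := (counitLeft_map f _).trans (by rw [J.counit_left, map_one])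
  counit_right := (counitRight_map f _).trans (by rw [J.counit_right, map_one])

end Map

section Basic

variable (J : Twist k A)

lemma cocycle_inv : leg12 k A ↑J.elem⁻¹ * comulLeft k A ↑J.elem⁻¹ =
    leg23 k A ↑J.elem⁻¹ * comulRight k A ↑J.elem⁻¹ := by
  have h : mapUnit (comulLeft k A) J.elem * mapUnit (leg12 k A) J.elem =
      mapUnit (comulRight k A) J.elem * mapUnit (leg23 k A) J.elem :=
    Units.ext J.cocycle
  have h2 := congrArg (fun u => ((u⁻¹ : (A ⊗[k] (A ⊗[k] A))ˣ) : A ⊗[k] (A ⊗[k] A))) h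
  simpa [mul_inv_rev] using h2

lemma hom_inv_mul {B : Type*} [Ring B] [Algebra k B] (f : A ⊗[k] A →ₐ[k] B) :
    f ↑J.elem⁻¹ * f J.elem = 1 := by rw [← map_mul, Units.inv_mul, map_one]

lemma hom_mul_inv {B : Type*} [Ring B] [Algebra k B] (f : A ⊗[k] A →ₐ[k] B) :
    f J.elem * f ↑J.elem⁻¹ = 1 := by rw [← map_mul, Units.mul_inv, map_one]

lemma counit_left_inv : counitLeft k A ↑J.elem⁻¹ = 1 := by
  simpa [J.counit_left] using J.hom_inv_mul (counitLeft k A)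

lemma counit_right_inv : counitRight k A ↑J.elem⁻¹ = 1 := by
  simpa [J.counit_right] using J.hom_inv_mul (counitRight k A)

lemma leg12_mul_leg23_inv : leg12 k A J.elem * leg23 k A ↑J.elem⁻¹ =
    comulLeft k A ↑J.elem⁻¹ * comulRight k A J.elem := by
  calc leg12 k A J.elem * leg23 k A ↑J.elem⁻¹
      = comulLeft k A ↑J.elem⁻¹ * (comulLeft k A J.elem * leg12 k A J.elem) *
          leg23 k A ↑J.elem⁻¹ := by
        rw [← mul_assoc, J.hom_inv_mul, one_mul]
    _ = _ := by rw [J.cocycle, mul_assoc, mul_assoc, J.hom_mul_inv, mul_one]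

lemma leg23_mul_leg12_inv : leg23 k A J.elem * leg12 k A ↑J.elem⁻¹ =
    comulRight k A ↑J.elem⁻¹ * comulLeft k A J.elem := by
  calc leg23 k A J.elem * leg12 k A ↑J.elem⁻¹
      = comulRight k A ↑J.elem⁻¹ * (comulRight k A J.elem * leg23 k A J.elem) *
          leg12 k A ↑J.elem⁻¹ := by
        rw [← mul_assoc, J.hom_inv_mul, one_mul]
    _ = _ := by rw [← J.cocycle, mul_assoc, mul_assoc, J.hom_mul_inv, mul_one]

/-- The invertible element `Q = m (S ⊗ id)(J)`. -/
def Q : Aˣ where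
  val := antL k 1 J.elem
  inv := antR k 1 ↑J.elem⁻¹
  val_inv := by
    rw [← antL3_legs, leg12_mul_leg23_inv, antL3_comul, J.counit_right, J.counit_left_inv]
    simp
  inv_val := by
    rw [← antR3_legs, leg23_mul_leg12_inv, antR3_comul, J.counit_right_inv, J.counit_left]
    simp

end Basic

end Twist

/-! ### The twisted Hopf algebra -/

section TwistedDef

variable {k A : Type*} [CommRing k] [Ring A] [HopfAlgebra k A]

/-- The Hopf algebra `A^J`: the algebra `A` with a new coalgebra structure and antipode. -/
def Twisted (_J : Twist k A) : Type _ := A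

variable (J : Twist k A)

instance : Ring (Twisted J) := ‹Ring A›

/-- `Δ^J (a) = J⁻¹ Δ(a) J`. -/
def comulTwist : A →ₐ[k] A ⊗[k] A :=
  (conjHom J.elem).comp (Bialgebra.comulAlgHom k A)

lemma comulTwist_apply (a : A) :
    comulTwist J a = (↑J.elem⁻¹ : A ⊗[k] A) * Coalgebra.comul a * (J.elem : A ⊗[k] A) := rfl

lemma map_comulTwist_left (x : A ⊗[k] A) :
    (Algebra.TensorProduct.assoc k k k A A A)
        (Algebra.TensorProduct.map (comulTwist J) (AlgHom.id k A) x) =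
      leg12 k A ↑J.elem⁻¹ * comulLeft k A x * leg12 k A J.elem := by
  have h12 : ∀ y : A ⊗[k] A, leg12 k A y =
      Algebra.TensorProduct.assoc k k k A A A (y ⊗ₜ[k] (1 : A)) := by
    intro y
    induction y with
    | zero => simp
    | tmul a b => simp
    | add x y hx hy => simp only [map_add, TensorProduct.add_tmul, hx, hy]
  induction x with
  | zero => simp
  | tmul a b =>
    rw [comulLeft_tmul, h12, h12, ← map_mul, ← map_mul]
    simp [comulTwist_apply]
  | add x y hx hy => simp only [map_add, mul_add, add_mul, hx, hy]

lemma map_comulTwist_right (x : A ⊗[k] A) :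
    Algebra.TensorProduct.map (AlgHom.id k A) (comulTwist J) x =
      leg23 k A ↑J.elem⁻¹ * comulRight k A x * leg23 k A J.elem := by
  have h23 : ∀ y : A ⊗[k] A, leg23 k A y = (1 : A) ⊗ₜ[k] y := fun _ => rfl
  induction x with
  | zero => simp
  | tmul a b =>
    rw [comulRight_tmul, h23, h23]
    simp [comulTwist_apply]
  | add x y hx hy => simp only [map_add, mul_add, add_mul, hx, hy]

lemma comulTwist_coassoc (a : A) :
    (Algebra.TensorProduct.assoc k k k A A A)
        (Algebra.TensorProduct.map (comulTwist J) (AlgHom.id k A) (comulTwist J a)) =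
      Algebra.TensorProduct.map (AlgHom.id k A) (comulTwist J) (comulTwist J a) := by
  rw [map_comulTwist_left, map_comulTwist_right, comulTwist_apply]
  simp only [map_mul]
  calc _ = (leg12 k A ↑J.elem⁻¹ * comulLeft k A ↑J.elem⁻¹) * comulLeft k A (Coalgebra.comul a) *
        (comulLeft k A J.elem * leg12 k A J.elem) := by simp only [mul_assoc]
    _ = _ := by rw [J.cocycle_inv, J.cocycle, comulLeft_comul]; simp only [mul_assoc]

lemma counitLeft_comulTwist (a : A) : counitLeft k A (comulTwist J a) = a := by
  rw [comulTwist_apply, map_mul, map_mul, J.counit_left, J.counit_left_inv, counitLeft_comul]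
  simp

lemma counitRight_comulTwist (a : A) : counitRight k A (comulTwist J a) = a := by
  rw [comulTwist_apply, map_mul, map_mul, J.counit_right, J.counit_right_inv, counitRight_comul]
  simp

/-- The bialgebra structure of `A^J`: the algebra and the counit are those of `A`, the
comultiplication is `Δ^J`. -/
abbrev twistBialgebra : Bialgebra k A :=
  Bialgebra.ofAlgHom (comulTwist J) (Bialgebra.counitAlgHom k A)
    (AlgHom.ext fun a => comulTwist_coassoc J a)
    (AlgHom.ext fun a => (Algebra.TensorProduct.lid k A).injective
      ((counitLeft_comulTwist J a).trans
        ((Algebra.TensorProduct.lid k A).apply_symm_apply a).symm))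
    (AlgHom.ext fun a => (Algebra.TensorProduct.rid k k A).injective
      ((counitRight_comulTwist J a).trans
        ((Algebra.TensorProduct.rid k k A).apply_symm_apply a).symm))

/-- `S^J (a) = Q⁻¹ S(a) Q`. -/
def antipodeTwist : A →ₗ[k] A :=
  LinearMap.mulLeft k (↑J.Q⁻¹ : A) ∘ₗ LinearMap.mulRight k (J.Q : A) ∘ₗ HopfAlgebra.antipode k

lemma antipodeTwist_apply (a : A) :
    antipodeTwist J a = (↑J.Q⁻¹ : A) * (HopfAlgebra.antipode k a * (J.Q : A)) := rfl

lemma antipodeTwist_left (a : A) :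
    LinearMap.mul' k A ((antipodeTwist J).rTensor A (comulTwist J a)) =
      algebraMap k A (Coalgebra.counit a) := by
  have h : ∀ x : A ⊗[k] A, LinearMap.mul' k A ((antipodeTwist J).rTensor A x) =
      (↑J.Q⁻¹ : A) * antL k (J.Q : A) x := by
    intro x
    induction x with
    | zero => simp
    | tmul a b => simp [antipodeTwist_apply, mul_assoc]
    | add x y hx hy => simp only [map_add, mul_add, hx, hy]
  have hQ : antL k (J.Q : A) ↑J.elem⁻¹ = 1 := by
    change antL k (antL k 1 (J.elem : A ⊗[k] A)) ↑J.elem⁻¹ = 1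
    rw [← antL_mul, Units.mul_inv, Algebra.TensorProduct.one_def, antL_tmul]
    simp
  rw [h, comulTwist_apply, antL_mul, antL_mul, hQ, antL_comul, antL_smul]
  change (↑J.Q⁻¹ : A) * (Coalgebra.counit (R := k) a • (J.Q : A)) = _
  rw [mul_smul_comm, Units.inv_mul, Algebra.algebraMap_eq_smul_one]

lemma antipodeTwist_right (a : A) :
    LinearMap.mul' k A ((antipodeTwist J).lTensor A (comulTwist J a)) =
      algebraMap k A (Coalgebra.counit a) := by
  have h : ∀ x : A ⊗[k] A, LinearMap.mul' k A ((antipodeTwist J).lTensor A x) =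
      antR k (↑J.Q⁻¹ : A) x * (J.Q : A) := by
    intro x
    induction x with
    | zero => simp
    | tmul a b => simp [antipodeTwist_apply, mul_assoc]
    | add x y hx hy => simp only [map_add, add_mul, hx, hy]
  have hQ : antR k (↑J.Q⁻¹ : A) (J.elem : A ⊗[k] A) = 1 := by
    change antR k (antR k 1 (↑J.elem⁻¹ : A ⊗[k] A)) (J.elem : A ⊗[k] A) = 1
    rw [← antR_mul, Units.mul_inv, Algebra.TensorProduct.one_def, antR_tmul]
    simp
  rw [h, comulTwist_apply, antR_mul, hQ, antR_mul, antR_comul, antR_smul]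
  change (Coalgebra.counit (R := k) a • (↑J.Q⁻¹ : A)) * (J.Q : A) = _
  rw [smul_mul_assoc, Units.inv_mul, Algebra.algebraMap_eq_smul_one]

/-- The Hopf algebra structure of `A^J`. -/
abbrev twistHopfAlgebra : HopfAlgebra k A :=
  { twistBialgebra J with
    antipode := antipodeTwist J
    mul_antipode_rTensor_comul := LinearMap.ext fun a => antipodeTwist_left J a
    mul_antipode_lTensor_comul := LinearMap.ext fun a => antipodeTwist_right J a }

instance : HopfAlgebra k (Twisted J) := twistHopfAlgebra (A := A) J

end TwistedDef

/-! ### Triangular structures -/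

/-- A triangular structure on a Hopf algebra `A`: a universal `R`-matrix `R` with `R⁻¹ = R₂₁`.
The pair of `A` and such a structure is a triangular Hopf algebra. -/
structure TriangularStructure (k A : Type*) [CommRing k] [Ring A] [HopfAlgebra k A] where
  /-- The universal `R`-matrix. -/
  R : (A ⊗[k] A)ˣ
  /-- `R₂₁ = R⁻¹`. -/
  unitary : flip k A R = (↑R⁻¹ : A ⊗[k] A)
  /-- `(Δ ⊗ id)(R) = R₁₃ R₂₃`. -/
  comul_left : comulLeft k A R = leg13 k A R * leg23 k A R
  /-- `(id ⊗ Δ)(R) = R₁₃ R₁₂`. -/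
  comul_right : comulRight k A R = leg13 k A R * leg12 k A R
  /-- `Δ^cop(a) R = R Δ(a)`. -/
  intertwine : ∀ a : A, flip k A (Coalgebra.comul a) * (R : A ⊗[k] A) = (R : A ⊗[k] A) * Coalgebra.comul a

namespace TriangularStructure

variable {k A : Type*} [CommRing k] [Ring A]

lemma comul_right_of_unitary [HopfAlgebra k A] (R : (A ⊗[k] A)ˣ)
    (h : flip k A R = (↑R⁻¹ : A ⊗[k] A))
    (hl : comulLeft k A R = leg13 k A R * leg23 k A R) :
    comulRight k A R = leg13 k A R * leg12 k A R := by
  apply (cyc k A).injective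
  rw [map_mul, cyc_comulRight, cyc_leg12, cyc_leg13, h]
  have h1 : mapUnit (comulLeft k A) R =
      mapUnit (leg13 k A) R * mapUnit (leg23 k A) R := Units.ext hl
  have h2 := congrArg (fun u => ((u⁻¹ : (A ⊗[k] (A ⊗[k] A))ˣ) : A ⊗[k] (A ⊗[k] A))) h1
  simpa [mul_inv_rev] using h2

/-- A cocommutative Hopf algebra is triangular with `R = 1 ⊗ 1`. -/
def one (k A : Type*) [CommRing k] [Ring A] [HopfAlgebra k A] [Coalgebra.IsCocomm k A] :
    TriangularStructure k A where
  R := 1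
  unitary := by simp
  comul_left := by simp
  comul_right := by simp
  intertwine a := by
    have h : flip k A (Coalgebra.comul a) = Coalgebra.comul a := Coalgebra.comm_comul k a
    simp [h]

/-- The computation in the group of invertible elements of `A ⊗ A ⊗ A` behind
`(Δ^J ⊗ id)(R^J) = R^J₁₃ R^J₂₃`. -/
lemma group_identity {G : Type*} [Group G]
    {CLF L12J L13R L23R CLJ CRJ L23J sCR sCL L13J L23F cCL L13F : G}
    (h1 : CLJ * L12J = CRJ * L23J) (h2 : L23R * CRJ = sCR * L23R)
    (h3 : sCL * L13J = sCR * L23F) (h4 : L13R * sCL = cCL * L13R)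
    (h5 : cCL * L13F = CLF * L12J) :
    L12J⁻¹ * (CLF⁻¹ * (L13R * L23R) * CLJ) * L12J =
      L13F⁻¹ * L13R * L13J * (L23F⁻¹ * L23R * L23J) := by
  have e5 : L12J⁻¹ * CLF⁻¹ = L13F⁻¹ * cCL⁻¹ := by
    rw [← mul_inv_rev, ← mul_inv_rev, h5]
  have e3 : sCR = sCL * L13J * L23F⁻¹ := by rw [h3]; group
  have e4 : L13R * sCL * L13R⁻¹ = cCL := by rw [h4]; group
  calc L12J⁻¹ * (CLF⁻¹ * (L13R * L23R) * CLJ) * L12J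
      = (L12J⁻¹ * CLF⁻¹) * L13R * (L23R * (CLJ * L12J)) := by group
    _ = L13F⁻¹ * cCL⁻¹ * L13R * ((L23R * CRJ) * L23J) := by rw [e5, h1]; group
    _ = L13F⁻¹ * cCL⁻¹ * L13R * (sCL * L13J * L23F⁻¹ * L23R * L23J) := by rw [h2, e3]
    _ = _ := by rw [← e4]; group

variable [HopfAlgebra k A] (T : TriangularStructure k A) (J : Twist k A)

/-- `R^J = J₂₁⁻¹ R J`. -/
def twistR : (A ⊗[k] A)ˣ :=
  (mapUnit (flip k A : A ⊗[k] A →ₐ[k] A ⊗[k] A) J.elem)⁻¹ * T.R * J.elem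

lemma twistR_unitary : flip k A (T.twistR J) = (↑(T.twistR J)⁻¹ : A ⊗[k] A) := by
  have h : mapUnit (flip k A : A ⊗[k] A →ₐ[k] A ⊗[k] A) T.R = T.R⁻¹ := Units.ext T.unitary
  have hh : ∀ u : (A ⊗[k] A)ˣ, mapUnit (flip k A : A ⊗[k] A →ₐ[k] A ⊗[k] A)
      (mapUnit (flip k A : A ⊗[k] A →ₐ[k] A ⊗[k] A) u) = u := fun u =>
    Units.ext ((flip k A).symm_apply_apply u)
  have : mapUnit (flip k A : A ⊗[k] A →ₐ[k] A ⊗[k] A) (T.twistR J) = (T.twistR J)⁻¹ := by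
    unfold twistR
    rw [map_mul, map_mul, map_inv, hh, h]
    group
  exact congrArg Units.val this

lemma twistR_intertwine (a : A) :
    flip k A (comulTwist J a) * (T.twistR J : A ⊗[k] A) =
      (T.twistR J : A ⊗[k] A) * comulTwist J a := by
  set F := mapUnit (flip k A : A ⊗[k] A →ₐ[k] A ⊗[k] A) J.elem with hF
  have h1 : flip k A (J.elem : A ⊗[k] A) = F := rfl
  have h2 : flip k A (↑J.elem⁻¹ : A ⊗[k] A) = (↑F⁻¹ : A ⊗[k] A) := rfl
  have h3 : (T.twistR J : A ⊗[k] A) = (↑F⁻¹ : A ⊗[k] A) * (T.R : A ⊗[k] A) * J.elem := rfl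
  rw [comulTwist_apply, map_mul, map_mul, h1, h2, h3]
  calc _ = (↑F⁻¹ : A ⊗[k] A) * flip k A (Coalgebra.comul a) * ((F : A ⊗[k] A) * ↑F⁻¹) *
        (T.R : A ⊗[k] A) * (J.elem : A ⊗[k] A) := by simp only [mul_assoc]
    _ = (↑F⁻¹ : A ⊗[k] A) * (flip k A (Coalgebra.comul a) * (T.R : A ⊗[k] A)) * (J.elem : A ⊗[k] A) := by
        rw [Units.mul_inv, mul_one]; simp only [mul_assoc]
    _ = (↑F⁻¹ : A ⊗[k] A) * (T.R : A ⊗[k] A) * ((J.elem : A ⊗[k] A) * ↑J.elem⁻¹) * Coalgebra.comul a *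
        (J.elem : A ⊗[k] A) := by
        rw [T.intertwine, Units.mul_inv, mul_one]; simp only [mul_assoc]
    _ = _ := by simp only [mul_assoc]

lemma twistR_comul_left :
    leg12 k A ↑J.elem⁻¹ * comulLeft k A (T.twistR J) * leg12 k A J.elem =
      leg13 k A (T.twistR J) * leg23 k A (T.twistR J) := by
  set F := mapUnit (flip k A : A ⊗[k] A →ₐ[k] A ⊗[k] A) J.elem with hF
  have h1 : mapUnit (comulLeft k A) J.elem * mapUnit (leg12 k A) J.elem =
      mapUnit (comulRight k A) J.elem * mapUnit (leg23 k A) J.elem :=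
    Units.ext J.cocycle
  have h2 : mapUnit (leg23 k A) T.R * mapUnit (comulRight k A) J.elem =
      mapUnit ((swap23 k A).comp (comulRight k A)) J.elem *
        mapUnit (leg23 k A) T.R :=
    Units.ext (leg23_mul_comulRight T.intertwine _)
  have h3 : mapUnit ((swap23 k A).comp (comulLeft k A)) J.elem *
        mapUnit (leg13 k A) J.elem =
      mapUnit ((swap23 k A).comp (comulRight k A)) J.elem *
        mapUnit (leg23 k A) F := by
    apply Units.ext
    have := congrArg (swap23 k A) J.cocycle
    rw [map_mul, map_mul, swap23_leg12, swap23_leg23] at this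
    exact this
  have h4 : mapUnit (leg13 k A) T.R *
        mapUnit ((swap23 k A).comp (comulLeft k A)) J.elem =
      mapUnit ((cyc k A).toAlgHom.comp (comulLeft k A)) J.elem *
        mapUnit (leg13 k A) T.R :=
    Units.ext (leg13_mul_swap23 T.intertwine _)
  have h5 : mapUnit ((cyc k A).toAlgHom.comp (comulLeft k A)) J.elem *
        mapUnit (leg13 k A) F =
      mapUnit (comulLeft k A) F * mapUnit (leg12 k A) J.elem := by
    apply Units.ext
    have := congrArg (cyc k A) J.cocycle
    rw [map_mul, map_mul, cyc_leg12, cyc_leg23, cyc_comulRight] at this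
    exact this
  have hR : mapUnit (comulLeft k A) T.R =
      mapUnit (leg13 k A) T.R * mapUnit (leg23 k A) T.R :=
    Units.ext T.comul_left
  have key := group_identity h1 h2 h3 h4 h5
  rw [← hR] at key
  have key' : (mapUnit (leg12 k A) J.elem)⁻¹ *
      mapUnit (comulLeft k A) (T.twistR J) * mapUnit (leg12 k A) J.elem =
      mapUnit (leg13 k A) (T.twistR J) *
        mapUnit (leg23 k A) (T.twistR J) := by
    unfold twistR
    simp only [map_mul, map_inv]
    exact key
  exact congrArg Units.val key'

/-- The triangular structure of `A^J`, on the type `A` itself. -/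
def twistAux : @TriangularStructure k A _ _ (twistHopfAlgebra J) :=
  @TriangularStructure.mk k A _ _ (twistHopfAlgebra J) (T.twistR J) (T.twistR_unitary J)
    ((map_comulTwist_left J _).trans (T.twistR_comul_left J))
    (@comul_right_of_unitary k A _ _ (twistHopfAlgebra J) (T.twistR J) (T.twistR_unitary J)
      ((map_comulTwist_left J _).trans (T.twistR_comul_left J)))
    (T.twistR_intertwine J)

/-- The triangular structure `R^J = J₂₁⁻¹ R J` on the twisted Hopf algebra `A^J`. -/
def twist : TriangularStructure k (Twisted J) :=
  twistAux (A := A) T J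

end TriangularStructure

/-- An isomorphism of triangular Hopf algebras `(A, R) → (B, R')`: an isomorphism `f` of Hopf
algebras (a bialgebra isomorphism; it automatically commutes with the antipodes) such that
`(f ⊗ f)(R) = R'`. -/
structure TriangularEquiv {k A B : Type*} [CommRing k] [Ring A] [HopfAlgebra k A]
    [Ring B] [HopfAlgebra k B] (T : TriangularStructure k A) (T' : TriangularStructure k B)
    extends A ≃ₐc[k] B where
  map_R : Algebra.TensorProduct.map (toBialgEquiv : A →ₐ[k] B) (toBialgEquiv : A →ₐ[k] B)
    (T.R : A ⊗[k] A) = (T'.R : B ⊗[k] B)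

end TwistedHopf

end

/-! Write `A = k[G]`, `B = k[G']`, let `f` be the given isomorphism, viewed as an algebra
isomorphism `A ≃ B`, and set `j = (f ⊗ f)(J)`. Compatibility with the twisted comultiplications says
that `Δ(f a) = K · (f ⊗ f)(Δ a) · K⁻¹` with `K = J' j⁻¹`, so `f` fails to be a map of untwisted Hopf
algebras only by conjugation by `K`. This `K` is itself a twist for `B` (`Twist.compare`), and the
equality of `R`-matrices says exactly that `K` is symmetric (`Twist.flip_compare`).

A symmetric twist of a finite-dimensional cocommutative Hopf algebra over an algebraically closed
field is trivial up to gauge (`exists_unit_comul_mul`). Indeed `a ↦ Δ(a) K` is a cocommutative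
coalgebra structure, its dual is a finite-dimensional commutative algebra and so has a character,
and that character is evaluation at some `x` with `Δ(x) K = x ⊗ x` and `ε(x) = 1`; such an `x` is
invertible.

Since `K = Δ(x)⁻¹ (x ⊗ x)`, following `f` by conjugation by `x` gives a bialgebra isomorphism `ψ : A
≃ B`, and `x⁻¹` gauges `(ψ ⊗ ψ)(J)` into `J'` (`exists_bialgEquiv_gaugeEquivalent`). Finally `ψ`
permutes group-like elements, so it comes from an isomorphism `G ≃ G'`
(`exists_eq_domCongrBialgEquiv`). -/

open scoped TensorProduct

noncomputable section

namespace TwistedHopf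

/-! ### Group-like elements of cocommutative coalgebras -/

section GroupLike

variable {k C : Type*} [Field k] [AddCommGroup C] [Module k C]

/-- Two elements of `C ⊗ C` agree if all products of linear functionals agree on them. -/
lemma tensor_ext_dual [FiniteDimensional k C] {x y : C ⊗[k] C}
    (h : ∀ f g : Module.Dual k C,
      LinearMap.mul' k k (TensorProduct.map f g x) = LinearMap.mul' k k (TensorProduct.map f g y)) :
    x = y := by
  rw [← sub_eq_zero, ← Module.forall_dual_apply_eq_zero_iff k]
  intro φ
  -- In finite dimension every functional on `C ⊗ C` is a sum of products `f ⊗ g`.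
  obtain ⟨t, rfl⟩ := (TensorProduct.dualDistribEquiv k C C).surjective φ
  induction t with
  | zero => simp
  | tmul f g =>
    have e : TensorProduct.dualDistribEquiv k C C (f ⊗ₜ g) =
        LinearMap.mul' k k ∘ₗ TensorProduct.map f g := by
      ext; simp [TensorProduct.dualDistribEquivOfBasis]
    rw [e, map_sub, sub_eq_zero]
    exact h f g
  | add s t hs ht => rw [map_add, LinearMap.add_apply, hs, ht, add_zero]

/-- A finite-dimensional commutative algebra over an algebraically closed field has a character. -/
lemma nonempty_character [IsAlgClosed k] (R : Type*) [CommRing R] [Nontrivial R] [Algebra k R]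
    [FiniteDimensional k R] : Nonempty (R →ₐ[k] k) := by
  -- The residue field at a maximal ideal is finite over `k`, hence equal to `k`; the quotient map
  -- is the character.
  obtain ⟨m, hm⟩ := Ideal.exists_maximal R
  let _ := Ideal.Quotient.field m
  exact ⟨(AlgEquiv.ofBijective (Algebra.ofId k (R ⧸ m))
    IsAlgClosed.algebraMap_bijective_of_isIntegral).symm.toAlgHom.comp (Ideal.Quotient.mkₐ k m)⟩

/-- A nonzero finite-dimensional cocommutative coalgebra over an algebraically closed field has a
group-like element. -/
lemma exists_isGroupLikeElem [IsAlgClosed k] [FiniteDimensional k C] [Coalgebra k C] [Coalgebra.IsCocomm k C]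
    [Nontrivial C] : ∃ x : C, IsGroupLikeElem k x := by
  -- `WithConv` puts the convolution product on the dual of `C`; it is commutative because `C` is
  -- cocommutative.
  let e : WithConv (C →ₗ[k] k) ≃ₗ[k] (C →ₗ[k] k) := WithConv.linearEquiv k _
  have : FiniteDimensional k (WithConv (C →ₗ[k] k)) := Module.Finite.equiv e.symm
  have : Nontrivial (C →ₗ[k] k) := inferInstanceAs (Nontrivial (Module.Dual k C))
  obtain ⟨χ⟩ := nonempty_character (k := k) (WithConv (C →ₗ[k] k))
  -- By reflexivity the character is evaluation at some `x`. Its value on the unit `ε` gives `ε(x) =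
  -- 1`, and multiplicativity reads `(f ⊗ g)(Δ x) = f(x) g(x)`, that is `Δ x = x ⊗ x`.
  obtain ⟨x, hx⟩ := (Module.evalEquiv k C).surjective (χ.toLinearMap ∘ₗ e.symm.toLinearMap)
  have hx' (f : C →ₗ[k] k) : f x = χ (WithConv.toConv f) := LinearMap.congr_fun hx f
  refine ⟨x, ?_, tensor_ext_dual fun f g => ?_⟩
  · have := hx' Coalgebra.counit
    rw [this, ← map_one χ]
    rfl
  · have h := hx' (WithConv.toConv f * WithConv.toConv g).ofConv
    rw [WithConv.toConv_ofConv, map_mul, ← hx', ← hx'] at h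
    simpa using h

end GroupLike

/-! ### Symmetric twists are gauge trivial -/

section Symmetric

variable {k A : Type*} [Field k] [Ring A] [HopfAlgebra k A] (K : Twist k A)

/-- The comultiplication `a ↦ Δ(a) K`. -/
def mulTwistComul : A →ₗ[k] A ⊗[k] A :=
  LinearMap.mulRight k (K.elem : A ⊗[k] A) ∘ₗ Coalgebra.comul

lemma mulTwistComul_apply (a : A) :
    mulTwistComul K a = Coalgebra.comul a * (K.elem : A ⊗[k] A) := rfl

/-- With `lTensor_mulTwistComul`, this turns coassociativity of `a ↦ Δ(a) K` into an identity
between legs of `K`. -/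
lemma assoc_rTensor_mulTwistComul (x : A ⊗[k] A) :
    TensorProduct.assoc k A A A ((mulTwistComul K).rTensor A x) =
      comulLeft k A x * leg12 k A K.elem := by
  have h12 : ∀ y : A ⊗[k] A, leg12 k A y =
      Algebra.TensorProduct.assoc k k k A A A (y ⊗ₜ[k] (1 : A)) := by
    intro y
    induction y with
    | zero => simp
    | tmul a b => simp
    | add x y hx hy => simp only [map_add, TensorProduct.add_tmul, hx, hy]
  induction x with
  | zero => simp
  | tmul a b =>
    rw [comulLeft_tmul, h12, ← map_mul, Algebra.TensorProduct.tmul_mul_tmul, mul_one]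
    rfl
  | add x y hx hy => simp only [map_add, add_mul, hx, hy]

lemma lTensor_mulTwistComul (x : A ⊗[k] A) :
    (mulTwistComul K).lTensor A x = comulRight k A x * leg23 k A K.elem := by
  induction x with
  | zero => simp
  | tmul a b =>
    have h23 : ∀ y : A ⊗[k] A, leg23 k A y = (1 : A) ⊗ₜ[k] y := fun _ => rfl
    rw [comulRight_tmul, h23, Algebra.TensorProduct.tmul_mul_tmul, mul_one]
    rfl
  | add x y hx hy => simp only [map_add, add_mul, hx, hy]

/-- The coalgebra structure on `A` with comultiplication `a ↦ Δ(a) K` and the counit of `A`. -/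
abbrev mulTwistCoalgebra : Coalgebra k A where
  comul := mulTwistComul K
  counit := Coalgebra.counit
  coassoc := by
    ext a
    change TensorProduct.assoc k A A A ((mulTwistComul K).rTensor A (mulTwistComul K a)) =
      (mulTwistComul K).lTensor A (mulTwistComul K a)
    -- Both sides are the iterated coproduct of `a` times one side of the cocycle identity for `K`.
    rw [assoc_rTensor_mulTwistComul, lTensor_mulTwistComul, mulTwistComul_apply, map_mul, map_mul,
      mul_assoc, mul_assoc, K.cocycle, comulLeft_comul]
  rTensor_counit_comp_comul := by
    ext a
    apply (TensorProduct.lid k A).injective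
    change counitLeft k A (Coalgebra.comul a * (K.elem : A ⊗[k] A)) = _
    rw [map_mul, counitLeft_comul, K.counit_left]
    simp
  lTensor_counit_comp_comul := by
    ext a
    apply (TensorProduct.rid k A).injective
    change counitRight k A (Coalgebra.comul a * (K.elem : A ⊗[k] A)) = _
    rw [map_mul, counitRight_comul, K.counit_right]
    simp

/-- An element with `Δ(x) K = x ⊗ x` and `ε(x) = 1` is invertible. -/
lemma isUnit_of_comul_mul [FiniteDimensional k A] {x : A} (hε : Coalgebra.counit (R := k) x = 1)
    (hx : Coalgebra.comul x * (K.elem : A ⊗[k] A) = x ⊗ₜ[k] x) : IsUnit x := by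
  have : IsArtinianRing A := IsArtinianRing.of_finite k A
  have h : Coalgebra.comul x = (x ⊗ₜ[k] x) * (↑K.elem⁻¹ : A ⊗[k] A) := by
    rw [← hx, Units.mul_inv_cancel_right]
  have h1 := antR_comul (k := k) x
  -- Applying `m (id ⊗ S)` to `Δ(x) = (x ⊗ x) K⁻¹` gives `1 = x p S(x)` with `p = m (id ⊗ S)(K⁻¹)`.
  -- This is only a right inverse; it is two-sided because `A` is Artinian.
  rw [hε, one_smul, h, antR_mul, antR_tmul] at h1
  exact IsUnit.of_mul_eq_one _ h1

/-- Over an algebraically closed field, a symmetric twist of a finite-dimensional cocommutative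
Hopf algebra is gauge equivalent to the trivial one. -/
lemma exists_unit_comul_mul [IsAlgClosed k] [FiniteDimensional k A] [Coalgebra.IsCocomm k A]
    [Nontrivial A] (hK : flip k A (K.elem : A ⊗[k] A) = K.elem) :
    ∃ x : Aˣ, Coalgebra.counit (R := k) (x : A) = 1 ∧
      Coalgebra.comul (x : A) * (K.elem : A ⊗[k] A) = (x : A) ⊗ₜ[k] (x : A) := by
  have hcocomm : @Coalgebra.IsCocomm k A _ _ _ (mulTwistCoalgebra K) := by
    refine @Coalgebra.IsCocomm.mk k A _ _ _ (mulTwistCoalgebra K) (LinearMap.ext fun a => ?_)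
    have h : flip k A (Coalgebra.comul a) = Coalgebra.comul a := Coalgebra.comm_comul k a
    change flip k A (Coalgebra.comul a * (K.elem : A ⊗[k] A)) =
      Coalgebra.comul a * (K.elem : A ⊗[k] A)
    rw [map_mul, h, hK]
  -- The coalgebra is passed explicitly so that "group-like" refers to `a ↦ Δ(a) K` and not to the
  -- comultiplication of `A`.
  obtain ⟨x, h1, h2⟩ := @exists_isGroupLikeElem k A _ _ _ _ _ (mulTwistCoalgebra K) hcocomm _
  change Coalgebra.comul x * (K.elem : A ⊗[k] A) = x ⊗ₜ[k] x at h2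
  obtain ⟨u, rfl⟩ := isUnit_of_comul_mul K h1 h2
  exact ⟨u, h1, h2⟩

end Symmetric

/-! ### The twist comparing `J'` with the image of `J` -/

section Comparison

variable {k A B : Type*} [CommRing k] [Ring A] [HopfAlgebra k A] [Ring B] [HopfAlgebra k B]

/-- `f ⊗ f`, for an algebra homomorphism `f`. -/
abbrev tmap2 (f : A →ₐ[k] B) : A ⊗[k] A →ₐ[k] B ⊗[k] B := Algebra.TensorProduct.map f f

/-- `f ⊗ f ⊗ f`, for an algebra homomorphism `f`. -/
abbrev tmap3 (f : A →ₐ[k] B) : A ⊗[k] (A ⊗[k] A) →ₐ[k] B ⊗[k] (B ⊗[k] B) :=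
  Algebra.TensorProduct.map f (tmap2 f)

variable (f : A →ₐ[k] B)

lemma leg12_tmap2 (x : A ⊗[k] A) : leg12 k B (tmap2 f x) = tmap3 f (leg12 k A x) := by
  induction x with
  | zero => simp
  | tmul a b => simp
  | add x y hx hy => simp only [map_add, hx, hy]

lemma leg23_tmap2 (x : A ⊗[k] A) : leg23 k B (tmap2 f x) = tmap3 f (leg23 k A x) := by
  induction x with
  | zero => simp
  | tmul a b => simp
  | add x y hx hy => simp only [map_add, hx, hy]

lemma flip_tmap2 (x : A ⊗[k] A) : flip k B (tmap2 f x) = tmap2 f (flip k A x) := by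
  induction x with
  | zero => simp
  | tmul a b => simp
  | add x y hx hy => simp only [map_add, hx, hy]

lemma counitLeft_tmap2
    (hε : ∀ a, Coalgebra.counit (R := k) (f a) = Coalgebra.counit (R := k) a) (x : A ⊗[k] A) :
    counitLeft k B (tmap2 f x) = f (counitLeft k A x) := by
  induction x with
  | zero => simp
  | tmul a b => simp [hε]
  | add x y hx hy => simp only [map_add, hx, hy]

lemma counitRight_tmap2
    (hε : ∀ a, Coalgebra.counit (R := k) (f a) = Coalgebra.counit (R := k) a) (x : A ⊗[k] A) :
    counitRight k B (tmap2 f x) = f (counitRight k A x) := by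
  induction x with
  | zero => simp
  | tmul a b => simp [hε]
  | add x y hx hy => simp only [map_add, hx, hy]

variable {f} {J : Twist k A} {J' : Twist k B}

lemma assoc_map_comulTwist_tmap2
    (hΔ : ∀ a, comulTwist J' (f a) = tmap2 f (comulTwist J a)) (x : A ⊗[k] A) :
    Algebra.TensorProduct.assoc k k k B B B
        (Algebra.TensorProduct.map (comulTwist J') (AlgHom.id k B) (tmap2 f x)) =
      tmap3 f (Algebra.TensorProduct.assoc k k k A A A
        (Algebra.TensorProduct.map (comulTwist J) (AlgHom.id k A) x)) := by
  induction x with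
  | zero => simp
  | tmul a b =>
    rw [Algebra.TensorProduct.map_tmul, Algebra.TensorProduct.map_tmul,
      Algebra.TensorProduct.map_tmul, hΔ]
    generalize comulTwist J a = y
    induction y with
    | zero => simp
    | tmul c d => rfl
    | add x y hx hy => simp only [map_add, TensorProduct.add_tmul, hx, hy]
  | add x y hx hy => simp only [map_add, hx, hy]

lemma map_comulTwist_tmap2
    (hΔ : ∀ a, comulTwist J' (f a) = tmap2 f (comulTwist J a)) (x : A ⊗[k] A) :
    Algebra.TensorProduct.map (AlgHom.id k B) (comulTwist J') (tmap2 f x) =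
      tmap3 f (Algebra.TensorProduct.map (AlgHom.id k A) (comulTwist J) x) := by
  induction x with
  | zero => simp
  | tmul a b =>
    rw [Algebra.TensorProduct.map_tmul, Algebra.TensorProduct.map_tmul,
      Algebra.TensorProduct.map_tmul, hΔ]
    rfl
  | add x y hx hy => simp only [map_add, hx, hy]

/-- The hypothesis `hΔ` applied in the first factor, with `J'₁₂⁻¹` moved to the other side: it is
the rule for commuting `(Δ ⊗ id)` of an image under `f ⊗ f` past `J'₁₂`. -/
lemma comulLeft_tmap2_mul_leg12
    (hΔ : ∀ a, comulTwist J' (f a) = tmap2 f (comulTwist J a)) (x : A ⊗[k] A) :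
    comulLeft k B (tmap2 f x) * leg12 k B J'.elem =
      leg12 k B J'.elem *
        tmap3 f (leg12 k A ↑J.elem⁻¹ * comulLeft k A x * leg12 k A J.elem) := by
  rw [← map_comulTwist_left, ← assoc_map_comulTwist_tmap2 hΔ, map_comulTwist_left,
    ← mul_assoc, ← mul_assoc, J'.hom_mul_inv, one_mul]

lemma comulRight_tmap2_mul_leg23
    (hΔ : ∀ a, comulTwist J' (f a) = tmap2 f (comulTwist J a)) (x : A ⊗[k] A) :
    comulRight k B (tmap2 f x) * leg23 k B J'.elem =
      leg23 k B J'.elem *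
        tmap3 f (leg23 k A ↑J.elem⁻¹ * comulRight k A x * leg23 k A J.elem) := by
  rw [← map_comulTwist_right, ← map_comulTwist_tmap2 hΔ, map_comulTwist_right,
    ← mul_assoc, ← mul_assoc, J'.hom_mul_inv, one_mul]

/-- If `f : A^J → B^{J'}` is a homomorphism of bialgebras, then `J' (f ⊗ f)(J)⁻¹` is a twist
for `B`. -/
def Twist.compare (hΔ : ∀ a, comulTwist J' (f a) = tmap2 f (comulTwist J a))
    (hε : ∀ a, Coalgebra.counit (R := k) (f a) = Coalgebra.counit (R := k) a) : Twist k B where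
  elem := J'.elem * (mapUnit (tmap2 f) J.elem)⁻¹
  cocycle := by
    have h : ((J'.elem * (mapUnit (tmap2 f) J.elem)⁻¹ : (B ⊗[k] B)ˣ) : B ⊗[k] B) =
      (J'.elem : B ⊗[k] B) * tmap2 f ↑J.elem⁻¹ := rfl
    -- Moving `J'₁₂` to the left cancels `J₁₂` against `J₁₂⁻¹` and leaves, inside `f ⊗ f ⊗ f`, one
    -- side of the inverted cocycle identity of `J`; `h2` gives the other side.
    have h1 : comulLeft k B (tmap2 f ↑J.elem⁻¹) * leg12 k B J'.elem *
        leg12 k B (tmap2 f ↑J.elem⁻¹) =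
          leg12 k B J'.elem * tmap3 f (leg12 k A ↑J.elem⁻¹ * comulLeft k A ↑J.elem⁻¹) := by
      rw [comulLeft_tmap2_mul_leg12 hΔ, leg12_tmap2, mul_assoc, ← map_mul, mul_assoc,
        J.hom_mul_inv, mul_one]
    have h2 : comulRight k B (tmap2 f ↑J.elem⁻¹) * leg23 k B J'.elem *
        leg23 k B (tmap2 f ↑J.elem⁻¹) =
          leg23 k B J'.elem * tmap3 f (leg23 k A ↑J.elem⁻¹ * comulRight k A ↑J.elem⁻¹) := by
      rw [comulRight_tmap2_mul_leg23 hΔ, leg23_tmap2, mul_assoc, ← map_mul, mul_assoc,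
        J.hom_mul_inv, mul_one]
    rw [h, map_mul, map_mul, map_mul, map_mul]
    calc _ = comulLeft k B J'.elem * (comulLeft k B (tmap2 f ↑J.elem⁻¹) * leg12 k B J'.elem *
          leg12 k B (tmap2 f ↑J.elem⁻¹)) := by simp only [mul_assoc]
      _ = comulRight k B J'.elem * (comulRight k B (tmap2 f ↑J.elem⁻¹) * leg23 k B J'.elem *
          leg23 k B (tmap2 f ↑J.elem⁻¹)) := by
        rw [h1, h2, ← mul_assoc, J'.cocycle, J.cocycle_inv, mul_assoc]
      _ = _ := by simp only [mul_assoc]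
  counit_left := by
    change counitLeft k B ((J'.elem : B ⊗[k] B) * tmap2 f ↑J.elem⁻¹) = 1
    rw [map_mul, J'.counit_left, counitLeft_tmap2 f hε, J.counit_left_inv, map_one, mul_one]
  counit_right := by
    change counitRight k B ((J'.elem : B ⊗[k] B) * tmap2 f ↑J.elem⁻¹) = 1
    rw [map_mul, J'.counit_right, counitRight_tmap2 f hε, J.counit_right_inv, map_one, mul_one]

/-- The hypothesis `hR` rearranges to `J'₂₁ (f ⊗ f)(J₂₁)⁻¹ = J' (f ⊗ f)(J)⁻¹`. This is the only use
of the `R`-matrices. -/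
lemma Twist.flip_compare (hΔ : ∀ a, comulTwist J' (f a) = tmap2 f (comulTwist J a))
    (hε : ∀ a, Coalgebra.counit (R := k) (f a) = Coalgebra.counit (R := k) a)
    (hR : tmap2 f (flip k A ↑J.elem⁻¹ * (J.elem : A ⊗[k] A)) =
      flip k B ↑J'.elem⁻¹ * (J'.elem : B ⊗[k] B)) :
    flip k B ((Twist.compare hΔ hε).elem : B ⊗[k] B) = (Twist.compare hΔ hε).elem := by
  change flip k B ((J'.elem : B ⊗[k] B) * tmap2 f ↑J.elem⁻¹) =
    (J'.elem : B ⊗[k] B) * tmap2 f ↑J.elem⁻¹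
  have h1 : flip k B (J'.elem : B ⊗[k] B) * flip k B ↑J'.elem⁻¹ = 1 :=
    J'.hom_mul_inv (flip k B).toAlgHom
  have h2 : tmap2 f (J.elem : A ⊗[k] A) * tmap2 f ↑J.elem⁻¹ = 1 := J.hom_mul_inv (tmap2 f)
  rw [map_mul] at hR
  rw [map_mul, flip_tmap2]
  calc _ = flip k B (J'.elem : B ⊗[k] B) *
        (tmap2 f (flip k A ↑J.elem⁻¹) * tmap2 f (J.elem : A ⊗[k] A)) * tmap2 f ↑J.elem⁻¹ := by
        rw [mul_assoc, mul_assoc, h2, mul_one]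
    _ = _ := by rw [hR, ← mul_assoc, h1, one_mul]

end Comparison

/-! ### From twisted to untwisted isomorphisms -/

section Main

variable {k A B : Type*} [Field k] [IsAlgClosed k] [Ring A] [HopfAlgebra k A]
  [Ring B] [HopfAlgebra k B] [FiniteDimensional k B] [Coalgebra.IsCocomm k B] [Nontrivial B]

/-- If `A^J` and `B^{J'}` are isomorphic triangular Hopf algebras (for the trivial `R`-matrices
on `A` and `B`), then there is an isomorphism `A ≃ B` of Hopf algebras that carries `J` to a twist
gauge equivalent to `J'`. -/
lemma exists_bialgEquiv_gaugeEquivalent {J : Twist k A} {J' : Twist k B} (e : A ≃ₐ[k] B)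
    (hΔ : ∀ a, comulTwist J' (e a) = tmap2 (e : A →ₐ[k] B) (comulTwist J a))
    (hε : ∀ a, Coalgebra.counit (R := k) (e a) = Coalgebra.counit (R := k) a)
    (hR : tmap2 (e : A →ₐ[k] B) (flip k A ↑J.elem⁻¹ * (J.elem : A ⊗[k] A)) =
      flip k B ↑J'.elem⁻¹ * (J'.elem : B ⊗[k] B)) :
    ∃ ψ : A ≃ₐc[k] B, (J.map ψ).GaugeEquivalent J' := by
  obtain ⟨x, hx1, hx⟩ := exists_unit_comul_mul (Twist.compare (f := (e : A →ₐ[k] B)) hΔ hε)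
    (Twist.flip_compare (f := (e : A →ₐ[k] B)) hΔ hε hR)
  have hxinv : Coalgebra.counit (R := k) (↑x⁻¹ : B) = 1 := by
    have h := Bialgebra.counit_mul (R := k) (x : B) ↑x⁻¹
    rwa [Units.mul_inv, Bialgebra.counit_one, hx1, one_mul, eq_comm] at h
  have hcc' : Coalgebra.comul (R := k) (↑x⁻¹ : B) * Coalgebra.comul (R := k) (x : B) = 1 := by
    rw [← Bialgebra.comul_mul, Units.inv_mul, Bialgebra.comul_one]
  have hxx : ((x : B) ⊗ₜ[k] (x : B)) * ((↑x⁻¹ : B) ⊗ₜ[k] (↑x⁻¹ : B)) = 1 := by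
    simp [Algebra.TensorProduct.one_def]
  have hxx' : ((↑x⁻¹ : B) ⊗ₜ[k] (↑x⁻¹ : B)) * ((x : B) ⊗ₜ[k] (x : B)) = 1 := by
    simp [Algebra.TensorProduct.one_def]
  set j := tmap2 (e : A →ₐ[k] B) (J.elem : A ⊗[k] A) with hj
  set ji := tmap2 (e : A →ₐ[k] B) (↑J.elem⁻¹ : A ⊗[k] A) with hji
  have hjj : j * ji = 1 := J.hom_mul_inv _
  have hjj' : ji * j = 1 := J.hom_inv_mul _
  replace hx : Coalgebra.comul (R := k) (x : B) * ((J'.elem : B ⊗[k] B) * ji) =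
    (x : B) ⊗ₜ[k] (x : B) := hx
  -- The inverse of `hx`, obtained as a left inverse of `x ⊗ x`.
  have hx' : j * (↑J'.elem⁻¹ : B ⊗[k] B) * Coalgebra.comul (R := k) (↑x⁻¹ : B) =
      (↑x⁻¹ : B) ⊗ₜ[k] (↑x⁻¹ : B) := by
    refine left_inv_eq_right_inv (a := (x : B) ⊗ₜ[k] (x : B)) ?_ hxx
    rw [← hx]
    calc _ = j * (↑J'.elem⁻¹ : B ⊗[k] B) * (Coalgebra.comul (R := k) (↑x⁻¹ : B) *
          Coalgebra.comul (R := k) (x : B)) * (J'.elem : B ⊗[k] B) * ji := by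
          simp only [mul_assoc]
      _ = _ := by rw [hcc', mul_one, Units.inv_mul_cancel_right, hjj]
  -- As `conjHom u` is `b ↦ u⁻¹ b u`, taking `u = x⁻¹` gives `b ↦ x b x⁻¹`.
  let c : B ≃ₐ[k] B := AlgEquiv.ofAlgHom (conjHom x⁻¹) (conjHom x)
    (by ext b; simp [conjHom_apply, mul_assoc]) (by ext b; simp [conjHom_apply, mul_assoc])
  have hc (b : B) : c b = x * b * ↑x⁻¹ := by
    change conjHom (k := k) x⁻¹ b = _
    rw [conjHom_apply, inv_inv]
  have hψ2 (y : A ⊗[k] A) : tmap2 ((e.trans c : A ≃ₐ[k] B) : A →ₐ[k] B) y =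
      ((x : B) ⊗ₜ[k] (x : B)) * tmap2 (e : A →ₐ[k] B) y * ((↑x⁻¹ : B) ⊗ₜ[k] (↑x⁻¹ : B)) := by
    induction y with
    | zero => simp
    | tmul a b => simp [hc]
    | add y z hy hz => simp only [map_add, mul_add, add_mul, hy, hz]
  have hcomul (a : A) : tmap2 ((e.trans c : A ≃ₐ[k] B) : A →ₐ[k] B) (Coalgebra.comul a) =
      Coalgebra.comul (e.trans c a) := by
    have h1 := hΔ a
    rw [comulTwist_apply, comulTwist_apply, map_mul, map_mul, ← hj, ← hji] at h1
    -- Conjugating by `Δ(x)` turns the factors `J' j⁻¹` and `j J'⁻¹` into `x ⊗ x` and its inverse,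
    -- by `hx` and `hx'`.
    have h2 : Coalgebra.comul (R := k) (e a) =
        (J'.elem : B ⊗[k] B) * (ji * tmap2 (e : A →ₐ[k] B) (Coalgebra.comul a) * j) *
          (↑J'.elem⁻¹ : B ⊗[k] B) := by
      rw [← h1]; simp [mul_assoc]
    rw [hψ2, AlgEquiv.trans_apply, hc, Bialgebra.comul_mul, Bialgebra.comul_mul, h2, ← hx, ← hx']
    simp only [mul_assoc]
  have hcounit (a : A) : Coalgebra.counit (R := k) (e.trans c a) =
      Coalgebra.counit (R := k) a := by
    rw [AlgEquiv.trans_apply, hc, Bialgebra.counit_mul, Bialgebra.counit_mul, hx1, hxinv, hε]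
    simp
  let ψ : A ≃ₐc[k] B := BialgEquiv.ofAlgEquiv (e.trans c) (AlgHom.ext hcounit) (AlgHom.ext hcomul)
  -- Solving `hx` for `J'` gives `J' = Δ(x⁻¹) (x ⊗ x) j = Δ(x⁻¹) (ψ ⊗ ψ)(J) (x ⊗ x)`, so the gauge
  -- is `x⁻¹`.
  refine ⟨ψ, x⁻¹, hxinv, ?_⟩
  have hψJ : ((J.map ψ).elem : B ⊗[k] B) =
      ((x : B) ⊗ₜ[k] (x : B)) * j * ((↑x⁻¹ : B) ⊗ₜ[k] (↑x⁻¹ : B)) := hψ2 _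
  rw [hψJ, inv_inv, ← hx]
  calc (J'.elem : B ⊗[k] B)
      = (Coalgebra.comul (R := k) (↑x⁻¹ : B) * Coalgebra.comul (R := k) (x : B)) *
        J'.elem * (ji * j) * (((↑x⁻¹ : B) ⊗ₜ[k] (↑x⁻¹ : B)) * ((x : B) ⊗ₜ[k] (x : B))) := by
        rw [hcc', hjj', hxx', one_mul, mul_one, mul_one]
    _ = _ := by rw [← hx]; simp only [mul_assoc]

end Main

/-! ### Specialisation to `R = 1 ⊗ 1` and to group algebras -/

lemma TriangularStructure.coe_one_twistR {k A : Type*} [CommRing k] [Ring A] [HopfAlgebra k A]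
    [Coalgebra.IsCocomm k A] (J : Twist k A) :
    ((TriangularStructure.one k A).twistR J : A ⊗[k] A) =
      flip k A ↑J.elem⁻¹ * (J.elem : A ⊗[k] A) := by
  change flip k A ↑J.elem⁻¹ * 1 * (J.elem : A ⊗[k] A) = _
  rw [mul_one]

/-- Every bialgebra isomorphism between group algebras over a domain is induced by an isomorphism
of groups. -/
lemma exists_eq_domCongrBialgEquiv {k G G' : Type*} [CommRing k] [IsDomain k] [Group G] [Group G']
    (ψ : MonoidAlgebra k G ≃ₐc[k] MonoidAlgebra k G') :
    ∃ φ : G ≃* G', ψ = MonoidAlgebra.domCongrBialgEquiv k k φ := by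
  -- Over a domain the group-like elements of a group algebra are exactly the group elements, so `ψ`
  -- and its inverse restrict to mutually inverse group homomorphisms.
  refine ⟨MonoidHom.toMulEquiv
    (MonoidAlgebra.mapDomainOfBialgHom (ψ : MonoidAlgebra k G →ₐc[k] MonoidAlgebra k G'))
    (MonoidAlgebra.mapDomainOfBialgHom (ψ.symm : MonoidAlgebra k G' →ₐc[k] MonoidAlgebra k G))
    ?_ ?_, ?_⟩
  · rw [← MonoidAlgebra.mapDomainOfBialgHom_comp, BialgEquiv.symm_comp,
      MonoidAlgebra.mapDomainOfBialgHom_id]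
  · rw [← MonoidAlgebra.mapDomainOfBialgHom_comp, BialgEquiv.comp_symm,
      MonoidAlgebra.mapDomainOfBialgHom_id]
  · apply BialgEquiv.ext
    intro a
    induction a using MonoidAlgebra.induction_linear with
    | zero => simp
    | add x y hx hy => rw [map_add, map_add, hx, hy]
    | single g r =>
      refine (MonoidAlgebra.single_mapDomainOfBialgHom
        (ψ : MonoidAlgebra k G →ₐc[k] MonoidAlgebra k G') g r).symm.trans ?_
      simp [MonoidAlgebra.domCongrBialgEquiv]

end TwistedHopf

end

theorem lemma5p7 {k : Type*} [Field k] [IsAlgClosed k] [CharZero k]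
    {G G' : Type*} [Group G] [Finite G] [Group G'] [Finite G']
    (J : TwistedHopf.Twist k (MonoidAlgebra k G)) (J' : TwistedHopf.Twist k (MonoidAlgebra k G'))
    (h : Nonempty (TwistedHopf.TriangularEquiv
      ((TwistedHopf.TriangularStructure.one k (MonoidAlgebra k G)).twist J)
      ((TwistedHopf.TriangularStructure.one k (MonoidAlgebra k G')).twist J'))) :
    ∃ φ : G ≃* G',
      TwistedHopf.Twist.GaugeEquivalent
        (J.map (MonoidAlgebra.domCongrBialgEquiv k k φ)) J' := by
  obtain ⟨f⟩ := h
  -- Twisting leaves the algebra and the counit unchanged, so `f` is also an algebra isomorphism of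
  -- the group algebras; only its compatibility with `Δ` involves the twists.
  let e : MonoidAlgebra k G ≃ₐ[k] MonoidAlgebra k G' := f.toBialgEquiv.toAlgEquiv
  have hΔ (a : MonoidAlgebra k G) : TwistedHopf.comulTwist J' (e a) =
      TwistedHopf.tmap2 (e : MonoidAlgebra k G →ₐ[k] MonoidAlgebra k G')
        (TwistedHopf.comulTwist J a) :=
    (LinearMap.congr_fun f.map_comp_comul a).symm
  have hε (a : MonoidAlgebra k G) : Coalgebra.counit (R := k) (e a) =
      Coalgebra.counit (R := k) a :=
    LinearMap.congr_fun f.counit_comp a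
  have hR : TwistedHopf.tmap2 (e : MonoidAlgebra k G →ₐ[k] MonoidAlgebra k G')
      (TwistedHopf.flip k _ ↑J.elem⁻¹ * J.elem.1) =
      TwistedHopf.flip k _ ↑J'.elem⁻¹ * J'.elem.1 := by
    rw [← TwistedHopf.TriangularStructure.coe_one_twistR,
      ← TwistedHopf.TriangularStructure.coe_one_twistR]
    exact f.map_R
  obtain ⟨ψ, hψ⟩ := TwistedHopf.exists_bialgEquiv_gaugeEquivalent e hΔ hε hR
  obtain ⟨φ, rfl⟩ := TwistedHopf.exists_eq_domCongrBialgEquiv ψ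
  exact ⟨φ, hψ⟩
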